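/- Let $n\ge 1$ and let $X_1,\dots,X_n$ be independent real-valued random variables, let $s\in\mathbb{R}$, put $p_i=\Pr(X_i>s)$ and $\lambda=\sum_{i=1}^n p_i$, and assume $\lambda>0$. Let $N=\sum_{i=1}^n \mathbf 1_{(s,\infty)}(X_i)$ be the number of exceedances above $s$. Write $\mathcal L(N^{(1)})$ for the conditional law of $N$ given $N\ge 1$ and $\mathrm{Pn}^{(1)}(\lambda)$ for the conditional law of $P$ given $P\ge 1$, where $P$ is Poisson distributed with mean $\lambda$. For probability distributions $Q_1,Q_2$ on $\{1,2,\dots\}$ let $d_{TV}(Q_1,Q_2)=\sup_{A\subset\{1,2,\dots\}}|Q_1(A)-Q_2(A)|$. Then $$d_{TV}\bigl(\mathcal L(N^{(1)}),\mathrm{Pn}^{(1)}(\lambda)\bigr)\le \frac{\dfrac{1-e^{-\lambda}-\lambda e^{-\lambda}}{\lambda(1-e^{-\lambda})}\displaystyle\sum_{i=1}^n p_i^2}{1-\displaystyle\prod_{i=1}^n(1-p_i)}.$$ Moreover, for fixed $n\ge1$ and $p_1=\dots=p_n=p$, the right-hand side is asymptotically equivalent to $p/2$ as $p\downarrow 0$,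 i.e. its ratio to $p/2$ tends to $1$. -/

import Mathlib

open MeasureTheory ProbabilityTheory Filter Topology Asymptotics
open scoped NNReal

noncomputable section

namespace Fragility

/-- The number of exceedances above the threshold `s`: the sum over `i` of
`𝟏_{(s, ∞)}(X i)`. -/
def numExceed {Ω : Type*} {n : ℕ} (X : Fin n → Ω → ℝ) (s : ℝ) (ω : Ω) : ℕ :=
  ∑ i, (Set.Ioi s).indicator (fun _ => 1) (X i ω)

/-- The law of `W` conditioned on the event `{W ≥ m}`, i.e. the law of `W^{(m)}`. -/
def condLawGE {Ω : Type*} [MeasurableSpace Ω] (μ : Measure Ω) (W : Ω → ℕ) (m : ℕ) : Measure ℕ :=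
  (ProbabilityTheory.cond μ {ω | m ≤ W ω}).map W

/-- The conditional Poisson distribution `Pn^{(m)}(lam)`: the law of `P` given `P ≥ m`, where `P`
(the identity on `ℕ` under the Poisson measure) is Poisson with mean `lam`. -/
def condPoisson (m : ℕ) (lam : ℝ≥0) : Measure ℕ :=
  condLawGE (poissonMeasure lam) (fun k => k) m

/-- The class of indicator functions of subsets of `{m, m + 1, …}`. -/
def indicatorClass (m : ℕ) : Set (ℕ → ℝ) :=
  {f | ∃ A : Set ℕ, A ⊆ Set.Ici m ∧ f = A.indicator (fun _ => 1)}

/-- Total variation distance between distributions on `{m, m + 1, …}`: the supremum of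
`|∫ f dQ₁ - ∫ f dQ₂|` over the indicators `f` of subsets of `{m, m + 1, …}`. -/
def dTV (m : ℕ) (Q₁ Q₂ : Measure ℕ) : ℝ :=
  ⨆ f : indicatorClass m, |∫ k, f.1 k ∂Q₁ - ∫ k, f.1 k ∂Q₂|

/-- The supremum defining `dTV` is over a set that is bounded above. -/
theorem dTV_bddAbove (m : ℕ) (Q₁ Q₂ : Measure ℕ) [IsProbabilityMeasure Q₁]
    [IsProbabilityMeasure Q₂] :
    BddAbove (Set.range fun f : indicatorClass m =>
      |∫ k, f.1 k ∂Q₁ - ∫ k, f.1 k ∂Q₂|) := by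
  refine ⟨1, ?_⟩
  rintro _ ⟨⟨_, A, -, rfl⟩, rfl⟩
  have h : ∀ Q : Measure ℕ, ∫ k, A.indicator (fun _ => (1 : ℝ)) k ∂Q = Q.real A := fun Q =>
    integral_indicator_one (MeasurableSet.of_discrete)
  simp only [h]
  rw [abs_le]
  constructor <;>
    linarith [measureReal_nonneg (μ := Q₁) (s := A), measureReal_nonneg (μ := Q₂) (s := A),
      measureReal_le_one (μ := Q₁) (s := A), measureReal_le_one (μ := Q₂) (s := A)]

/-- The bound
`[(1 - e^{-lam} - lam e^{-lam}) / (lam (1 - e^{-lam}))] (∑ p_i²) / (1 - ∏ (1 - p_i))`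
with `lam = ∑ p_i`. -/
def errorBound {n : ℕ} (p : Fin n → ℝ) : ℝ :=
  let lam : ℝ := ∑ i, p i
  ((1 - Real.exp (-lam) - lam * Real.exp (-lam)) / (lam * (1 - Real.exp (-lam))) * ∑ i, p i ^ 2)
    / (1 - ∏ i, (1 - p i))

end Fragility

end

/-! The proof is Stein's method for the Poisson law conditioned to be positive. Let `q k` be its
mass at `k + 1`. For a test function `f` with mean `c`, solve `lam * h (k + 1) = (k + 1) * h k + (f
k - c)` with `h 0 = 0`. For `W` the sum of the indicators, `lam * h W - W * h (W - 1)` is then `f (W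
- 1) - c` when `W ≥ 1` and vanishes when `W = 0`. Its unconditional mean is therefore `P(W ≥ 1)`
times the difference of the conditional means, so conditioning never destroys independence.

That mean is bounded by `∑ p_i²` times the largest increment of `h`
(`abs_integral_stein_operator_le`), and `abs_stein_increment_le` bounds the increments by `(1 - q 0)
/ lam`, which is the stated factor. -/

/-! ### Increments of the Stein solution -/

/-- Partial sums of weights with `(k + 2) q (k + 1) = lam q k`, compared with the shifted ones. -/
theorem mul_sum_range_le_of_rec {q : ℕ → ℝ} {lam : ℝ} (hq : ∀ k, 0 < q k)
    (hrec : ∀ k, (k + 2) * q (k + 1) = lam * q k) (k : ℕ) :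
    lam * ∑ i ∈ Finset.range k, q i ≤
      (k + 1) * (∑ i ∈ Finset.range (k + 1), q i - q 0) := by
  rw [Finset.sum_range_succ', add_sub_cancel_right, Finset.mul_sum, Finset.mul_sum]
  refine Finset.sum_le_sum fun i hi => ?_
  rw [← hrec i]
  have : (i : ℝ) + 1 ≤ k := by exact_mod_cast Finset.mem_range.1 hi
  exact mul_le_mul_of_nonneg_right (by linarith) (hq _).le

/-- Tails of weights with `(k + 2) q (k + 1) = lam q k`, compared with the shifted ones. -/
theorem mul_tsum_tail_le_of_rec {q : ℕ → ℝ} {lam : ℝ} (hq : ∀ k, 0 < q k)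
    (hrec : ∀ k, (k + 2) * q (k + 1) = lam * q k) (hs : Summable q) (k : ℕ) :
    (k + 1) * ∑' i, q (i + (k + 1)) ≤ lam * ∑' i, q (i + k) := by
  rw [← tsum_mul_left, ← tsum_mul_left]
  refine Summable.tsum_le_tsum (fun i => ?_)
    (((summable_nat_add_iff (k + 1)).2 hs).mul_left _) (((summable_nat_add_iff k).2 hs).mul_left _)
  have h := hrec (i + k)
  rw [← h]
  push_cast
  exact mul_le_mul_of_nonneg_right (by linarith [(Nat.cast_nonneg i : (0 : ℝ) ≤ i)]) (hq _).le

/-- The weights are a summing factor: multiplying the Stein equation by `q k` turns `lam * q k` into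
`(k + 2) * q (k + 1)`, and the recursion telescopes. -/
theorem stein_mul_eq_sum {q f h : ℕ → ℝ} {lam c : ℝ}
    (hrec : ∀ k, (k + 2) * q (k + 1) = lam * q k) (h0 : h 0 = 0)
    (hh : ∀ k, lam * h (k + 1) = (k + 1) * h k + (f k - c)) (k : ℕ) :
    (k + 1) * q k * h k =
      ∑ i ∈ Finset.range k, q i * f i - c * ∑ i ∈ Finset.range k, q i := by
  induction k with
  | zero => simp [h0]
  | succ k ih =>
    rw [Finset.sum_range_succ, Finset.sum_range_succ]
    have h1 := hrec k
    have h2 := hh k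
    push_cast
    linear_combination ih + h (k + 1) * h1 + q k * h2

/-- One-sided bound on the increments of the solution of the Stein equation. -/
theorem stein_increment_le {q f h : ℕ → ℝ} {lam : ℝ} (hlam : 0 < lam) (hq : ∀ k, 0 < q k)
    (hrec : ∀ k, (k + 2) * q (k + 1) = lam * q k) (hs : HasSum q 1)
    (hf0 : ∀ k, 0 ≤ f k) (hf1 : ∀ k, f k ≤ 1) (h0 : h 0 = 0)
    (hh : ∀ k, lam * h (k + 1) = (k + 1) * h k + (f k - ∑' i, q i * f i)) (k : ℕ) :
    h (k + 1) - h k ≤ (1 - q 0) / lam := by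
  have hsf : Summable fun i => q i * f i :=
    Summable.of_nonneg_of_le (fun i => mul_nonneg (hq i).le (hf0 i))
      (fun i => mul_le_of_le_one_right (hq i).le (hf1 i)) hs.summable
  set c := ∑' i, q i * f i with hc
  set U := ∑ i ∈ Finset.range k, q i * f i with hU
  set F := ∑ i ∈ Finset.range k, q i with hF
  set V := ∑' i, q (i + (k + 1)) * f (i + (k + 1)) with hV
  set T := ∑' i, q (i + (k + 1)) with hT
  have hqk := hq k
  have hUV : U + q k * f k + V = c := by
    rw [hU, hV, ← Finset.sum_range_succ, hsf.sum_add_tsum_nat_add (k + 1)]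
  have hFT : F + q k + T = 1 := by
    rw [hF, hT, ← Finset.sum_range_succ, hs.summable.sum_add_tsum_nat_add (k + 1), hs.tsum_eq]
  have hFT' : F + ∑' i, q (i + k) = 1 := by
    rw [hF, hs.summable.sum_add_tsum_nat_add k, hs.tsum_eq]
  have hA := mul_tsum_tail_le_of_rec hq hrec hs.summable k
  have hC := mul_sum_range_le_of_rec hq hrec k
  rw [Finset.sum_range_succ, ← hF] at hC
  have hU0 : 0 ≤ U := Finset.sum_nonneg fun i _ => mul_nonneg (hq i).le (hf0 i)
  have hV0 : 0 ≤ V := tsum_nonneg fun i => mul_nonneg (hq _).le (hf0 _)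
  have hm := stein_mul_eq_sum hrec h0 hh k
  rw [← hU, ← hF] at hm
  have hhk := hh k
  have hk : (0 : ℝ) < k + 1 := by positivity
  have hT' : ∑' i, q (i + k) = q k + T := by linarith
  rw [← hT, hT'] at hA
  have hT1 : T = 1 - F - q k := by linarith
  have hq0 : q 0 ≤ 1 := by
    rw [← hs.tsum_eq]; exact hs.summable.le_tsum 0 fun i _ => (hq i).le
  -- The values of `f` below `k` (in `U`) and above `k` (in `V`) only decrease the increment, so the
  -- worst test function is the indicator of `{k}`.
  have key : (k + 1) * q k * (lam * (h (k + 1) - h k)) =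
      U * ((k + 1) * T - lam * (q k + T)) - V * ((k + 1) * (F + q k) - lam * F)
        + q k * f k * ((k + 1) * T + lam * F) := by
    have e1 : (k + 1) * q k * (lam * (h (k + 1) - h k)) =
        ((k + 1) - lam) * ((k + 1) * q k * h k) + (k + 1) * q k * (f k - c) := by
      linear_combination (k + 1) * q k * hhk
    rw [e1, hm, ← hUV, hT1]
    ring
  have hB : lam * F ≤ (k + 1) * (F + q k) := by nlinarith [mul_pos hk (hq 0)]
  have b1 : U * ((k + 1) * T - lam * (q k + T)) ≤ 0 :=
    mul_nonpos_of_nonneg_of_nonpos hU0 (by linarith)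
  have b2 : 0 ≤ V * ((k + 1) * (F + q k) - lam * F) := mul_nonneg hV0 (by linarith)
  have b3 : q k * f k * ((k + 1) * T + lam * F) ≤ q k * ((k + 1) * (1 - q 0)) := by
    have t0 : 0 ≤ (k + 1) * (1 - q 0) := mul_nonneg hk.le (by linarith)
    have t1 : (k + 1) * T + lam * F ≤ (k + 1) * (1 - q 0) := by rw [hT1]; linarith
    calc q k * f k * ((k + 1) * T + lam * F) ≤ q k * f k * ((k + 1) * (1 - q 0)) :=
          mul_le_mul_of_nonneg_left t1 (mul_nonneg hqk.le (hf0 k))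
      _ ≤ q k * ((k + 1) * (1 - q 0)) :=
          mul_le_mul_of_nonneg_right (mul_le_of_le_one_right hqk.le (hf1 k)) t0
  rw [le_div_iff₀ hlam]
  refine le_of_mul_le_mul_left ?_ (mul_pos hk hqk)
  linarith

/-- Replacing `f` by `1 - f` changes the sign of `h`, so the one-sided bound gives both. -/
theorem abs_stein_increment_le {q f h : ℕ → ℝ} {lam : ℝ} (hlam : 0 < lam) (hq : ∀ k, 0 < q k)
    (hrec : ∀ k, (k + 2) * q (k + 1) = lam * q k) (hs : HasSum q 1)
    (hf0 : ∀ k, 0 ≤ f k) (hf1 : ∀ k, f k ≤ 1) (h0 : h 0 = 0)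
    (hh : ∀ k, lam * h (k + 1) = (k + 1) * h k + (f k - ∑' i, q i * f i)) (k : ℕ) :
    |h (k + 1) - h k| ≤ (1 - q 0) / lam := by
  refine abs_le'.2 ⟨stein_increment_le hlam hq hrec hs hf0 hf1 h0 hh k, ?_⟩
  have hsf : Summable fun i => q i * f i :=
    Summable.of_nonneg_of_le (fun i => mul_nonneg (hq i).le (hf0 i))
      (fun i => mul_le_of_le_one_right (hq i).le (hf1 i)) hs.summable
  have hc : ∑' i, q i * (1 - f i) = 1 - ∑' i, q i * f i := by
    simp_rw [mul_sub, mul_one]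
    rw [hs.summable.tsum_sub hsf, hs.tsum_eq]
  have := stein_increment_le (f := fun i => 1 - f i) (h := fun i => -h i) hlam hq hrec hs
    (fun i => by linarith [hf1 i]) (fun i => by linarith [hf0 i]) (by simp [h0])
    (fun i => by rw [hc]; linarith [hh i]) k
  linarith

/-! ### Asymptotics for small probabilities -/

theorem tendsto_poisson_stein_factor :
    Tendsto (fun x : ℝ => (1 - Real.exp (-x) - x * Real.exp (-x)) / (x * (1 - Real.exp (-x))))
      (𝓝[>] 0) (𝓝 (1 / 2)) := by
  have hexp : ∀ x : ℝ, HasDerivAt (fun y : ℝ => Real.exp (-y)) (-Real.exp (-x)) x := fun x => by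
    simpa using (hasDerivAt_neg x).exp
  have hcont : Tendsto (fun x : ℝ => Real.exp (-x)) (𝓝[>] 0) (𝓝 1) := by
    have : Continuous fun x : ℝ => Real.exp (-x) := by fun_prop
    simpa using (this.tendsto 0).mono_left nhdsWithin_le_nhds
  have hid : Tendsto (fun x : ℝ => x) (𝓝[>] 0) (𝓝 0) := nhdsWithin_le_nhds
  have h1 : Tendsto (fun x : ℝ => (1 - Real.exp (-x) - x * Real.exp (-x)) / x ^ 2)
      (𝓝[>] 0) (𝓝 (1 / 2)) := by
    refine HasDerivAt.lhopital_zero_nhdsGT (f' := fun x => x * Real.exp (-x))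
      (g' := fun x => 2 * x) ?_ ?_ ?_ ?_ ?_ ?_
    · refine Eventually.of_forall fun x => ?_
      exact (((hexp x).const_sub 1).sub ((hasDerivAt_id x).mul (hexp x))).congr_deriv
        (by simp only [id_eq]; ring)
    · refine Eventually.of_forall fun x => ?_
      simpa using hasDerivAt_pow 2 x
    · filter_upwards [self_mem_nhdsWithin] with x hx
      have : (0 : ℝ) < x := hx
      positivity
    · simpa using (hcont.const_sub 1).sub (hid.mul hcont)
    · simpa using hid.pow 2
    · have : Tendsto (fun x : ℝ => Real.exp (-x) / 2) (𝓝[>] 0) (𝓝 (1 / 2)) := hcont.div_const 2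
      refine this.congr' ?_
      filter_upwards [self_mem_nhdsWithin] with x hx
      have : (x : ℝ) ≠ 0 := ne_of_gt hx
      field_simp
  have h2 : Tendsto (fun x : ℝ => (1 - Real.exp (-x)) / x) (𝓝[>] 0) (𝓝 1) := by
    have hd : HasDerivAt (fun y : ℝ => 1 - Real.exp (-y)) 1 0 := by
      simpa using (hexp 0).const_sub 1
    refine (hd.tendsto_slope.mono_left (nhdsWithin_mono 0 fun x hx => ne_of_gt hx)).congr
      fun x => ?_
    simp [slope_def_field]
  have h3 := h1.div h2 one_ne_zero
  rw [div_one] at h3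
  refine h3.congr' ?_
  filter_upwards [self_mem_nhdsWithin] with x hx
  have hx0 : (x : ℝ) ≠ 0 := ne_of_gt hx
  have : 1 - Real.exp (-x) ≠ 0 := by
    have : Real.exp (-x) < 1 := Real.exp_lt_one_iff.2 (neg_lt_zero.2 hx)
    linarith
  simp only [Pi.div_apply]
  field_simp

theorem isEquivalent_errorBound {n : ℕ} (hn : 1 ≤ n) :
    IsEquivalent (𝓝[>] (0 : ℝ)) (fun q : ℝ => Fragility.errorBound (fun _ : Fin n => q))
      (fun q : ℝ => q / 2) := by
  have hn0 : (0 : ℝ) < n := by exact_mod_cast hn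
  have hpos : ∀ᶠ q : ℝ in 𝓝[>] 0, q ∈ Set.Ioo (0 : ℝ) 1 := Ioo_mem_nhdsGT one_pos
  rw [isEquivalent_iff_tendsto_one (hpos.mono fun q hq => by have := hq.1; positivity)]
  have hmul : Tendsto (fun q : ℝ => n * q) (𝓝[>] 0) (𝓝[>] 0) := by
    refine tendsto_nhdsWithin_iff.2 ⟨?_, ?_⟩
    · have : Continuous fun q : ℝ => n * q := by fun_prop
      simpa using (this.tendsto 0).mono_left nhdsWithin_le_nhds
    · filter_upwards [hpos] with q hq using mul_pos hn0 hq.1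
  have h1 := tendsto_poisson_stein_factor.comp hmul
  have h2 : Tendsto (fun q : ℝ => (1 - (1 - q) ^ n) / q) (𝓝[>] 0) (𝓝 n) := by
    have hd : HasDerivAt (fun y : ℝ => 1 - (1 - y) ^ n) n 0 := by
      simpa using (((hasDerivAt_id (0 : ℝ)).const_sub 1).pow n).const_sub 1
    refine (hd.tendsto_slope.mono_left (nhdsWithin_mono 0 fun x hx => ne_of_gt hx)).congr
      fun x => ?_
    simp [slope_def_field]
  have h3 := (h1.mul_const (2 * (n : ℝ))).div h2 hn0.ne'
  have h4 : 1 / 2 * (2 * (n : ℝ)) / n = 1 := by field_simp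
  rw [h4] at h3
  refine h3.congr' ?_
  filter_upwards [hpos] with q hq
  have hq0 := hq.1.ne'
  have hne : 1 - (1 - q) ^ n ≠ 0 := by
    have : (1 - q) ^ n < 1 := pow_lt_one₀ (by linarith [hq.2]) (by linarith [hq.1]) (by omega)
    linarith
  simp only [Fragility.errorBound, Pi.div_apply, Function.comp_apply, Finset.sum_const,
    Finset.prod_const, Finset.card_univ, Fintype.card_fin, nsmul_eq_mul]
  -- The Stein factor is kept opaque; only the powers of `n` and `q` have to cancel.
  generalize (1 - Real.exp (-(n * q)) - n * q * Real.exp (-(n * q))) /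
    (n * q * (1 - Real.exp (-(n * q)))) = C
  field_simp

/-! ### The Stein operator on Bernoulli sums -/

theorem integrable_comp_of_nat_le {Ω : Type*} [MeasurableSpace Ω] {μ : Measure Ω}
    [IsFiniteMeasure μ] {V : Ω → ℕ} (hV : Measurable V) {m : ℕ} (hm : ∀ ω, V ω ≤ m)
    (φ : ℕ → ℝ) : Integrable (fun ω => φ (V ω)) μ := by
  refine Integrable.of_bound ((measurable_of_countable φ).comp hV).aestronglyMeasurable
    (∑ k ∈ Finset.range (m + 1), |φ k|) (ae_of_all _ fun ω => ?_)
  exact Finset.single_le_sum (f := fun k => |φ k|) (fun _ _ => abs_nonneg _)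
    (Finset.mem_range.2 (Nat.lt_succ_of_le (hm ω)))

/-- The Poisson Stein operator applied to a sum of independent Bernoulli variables. -/
theorem abs_integral_stein_operator_le {Ω ι : Type*} [Fintype ι] [DecidableEq ι]
    [MeasurableSpace Ω] {μ : Measure Ω} [IsProbabilityMeasure μ] {I : ι → Ω → ℕ}
    (hmeas : ∀ i, Measurable (I i)) (hind : iIndepFun I μ) (hI : ∀ i ω, I i ω = 0 ∨ I i ω = 1)
    {p : ι → ℝ} (hp : ∀ i, ∫ ω, (I i ω : ℝ) ∂μ = p i) {h : ℕ → ℝ} {C : ℝ}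
    (hC : ∀ k, |h (k + 1) - h k| ≤ C) :
    |∫ ω, ((∑ i, p i) * h (∑ i, I i ω) - (∑ i, I i ω : ℕ) * h (∑ i, I i ω - 1)) ∂μ| ≤
      C * ∑ i, p i ^ 2 := by
  set V : ι → Ω → ℕ := fun i => ∑ j ∈ Finset.univ.erase i, I j with hVdef
  have hVm : ∀ i, Measurable (V i) := fun i => by
    simpa only [hVdef, ← Finset.sum_fn] using
      Finset.measurable_fun_sum (Finset.univ.erase i) fun j _ => hmeas j
  have hI1 : ∀ i ω, I i ω ≤ 1 := fun i ω => by rcases hI i ω with h | h <;> omega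
  have hVle : ∀ i ω, V i ω ≤ Fintype.card ι := fun i ω => by
    simp only [hVdef, Finset.sum_apply]
    calc ∑ j ∈ Finset.univ.erase i, I j ω ≤ ∑ j ∈ Finset.univ.erase i, 1 :=
          Finset.sum_le_sum fun j _ => hI1 j ω
      _ ≤ Fintype.card ι := by simp
  have hWV : ∀ i ω, ∑ j, I j ω = V i ω + I i ω := fun i ω => by
    simp only [hVdef, Finset.sum_apply]
    rw [Finset.sum_erase_add _ _ (Finset.mem_univ i)]
  have hVI : ∀ i, IndepFun (I i) (V i) μ := fun i =>
    (hind.indepFun_finsetSum_of_notMem hmeas (Finset.notMem_erase i _)).symm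
  have hprod : ∀ i (φ : ℕ → ℝ), ∫ ω, (I i ω : ℝ) * φ (V i ω) ∂μ = p i * ∫ ω, φ (V i ω) ∂μ :=
    fun i φ => by
      rw [← hp i]
      exact (hVI i).integral_fun_comp_mul_comp (f := fun k : ℕ => (k : ℝ))
        (hmeas i).aemeasurable (hVm i).aemeasurable
        (measurable_of_countable _).aestronglyMeasurable
        (measurable_of_countable _).aestronglyMeasurable
  have hint : ∀ i (φ : ℕ → ℝ), Integrable (fun ω => φ (V i ω)) μ := fun i φ =>
    integrable_comp_of_nat_le (hVm i) (hVle i) φ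
  have hintI : ∀ i (φ : ℕ → ℝ), Integrable (fun ω => (I i ω : ℝ) * φ (V i ω)) μ := fun i φ => by
    refine (hint i φ).bdd_mul (c := 1) (((measurable_of_countable (fun k : ℕ => (k : ℝ))).comp
      (hmeas i)).aestronglyMeasurable) (ae_of_all _ fun ω => ?_)
    simpa using hI1 i ω
  -- Leave-one-out: if `I i = 1` then `W - 1 = V i`. By independence the first two terms cancel in
  -- mean and the last contributes `p i ^ 2` times a mean increment.
  have hpt : ∀ ω, (∑ i, p i) * h (∑ i, I i ω) - (∑ i, I i ω : ℕ) * h (∑ i, I i ω - 1) =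
      ∑ i, (p i * h (V i ω) - (I i ω : ℝ) * h (V i ω) +
        p i * ((I i ω : ℝ) * (h (V i ω + 1) - h (V i ω)))) := fun ω => by
    rw [Nat.cast_sum, Finset.sum_mul, Finset.sum_mul, ← Finset.sum_sub_distrib]
    refine Finset.sum_congr rfl fun i _ => ?_
    rw [hWV i ω]
    rcases hI i ω with h0 | h1
    · simp [h0]
    · simp only [h1, Nat.add_sub_cancel]
      push_cast
      ring
  simp_rw [hpt]
  have hi1 : ∀ i, Integrable (fun ω => p i * h (V i ω)) μ := fun i => (hint i h).const_mul _
  have hi2 : ∀ i, Integrable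
      (fun ω => p i * ((I i ω : ℝ) * (h (V i ω + 1) - h (V i ω)))) μ := fun i =>
    (hintI i fun k => h (k + 1) - h k).const_mul _
  have hi3 : ∀ i, Integrable (fun ω => p i * h (V i ω) - (I i ω : ℝ) * h (V i ω) +
      p i * ((I i ω : ℝ) * (h (V i ω + 1) - h (V i ω)))) μ := fun i =>
    ((hi1 i).sub (hintI i h)).add (hi2 i)
  have hi4 : ∀ i, Integrable (fun ω => p i * h (V i ω) - (I i ω : ℝ) * h (V i ω)) μ := fun i =>
    (hi1 i).sub (hintI i h)
  rw [integral_finsetSum _ fun i _ => hi3 i, Finset.mul_sum]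
  refine (Finset.abs_sum_le_sum_abs _ _).trans (Finset.sum_le_sum fun i _ => ?_)
  rw [integral_add (hi4 i) (hi2 i), integral_sub (hi1 i) (hintI i h),
    integral_const_mul, integral_const_mul, hprod i h, hprod i fun k => h (k + 1) - h k,
    sub_self, zero_add, ← mul_assoc, ← pow_two, abs_mul, abs_of_nonneg (sq_nonneg (p i)),
    mul_comm]
  refine mul_le_mul_of_nonneg_right ?_ (sq_nonneg _)
  have := norm_integral_le_of_norm_le_const (μ := μ)
    (f := fun ω => h (V i ω + 1) - h (V i ω)) (ae_of_all _ fun ω => hC (V i ω))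
  simpa using this

/-! ### Integrals against the conditional laws -/

theorem integral_condLawGE {Ω : Type*} [MeasurableSpace Ω] (μ : Measure Ω) {W : Ω → ℕ}
    (hW : Measurable W) (m : ℕ) (φ : ℕ → ℝ) :
    ∫ k, φ k ∂(Fragility.condLawGE μ W m) =
      (μ.real {ω | m ≤ W ω})⁻¹ * ∫ ω in {ω | m ≤ W ω}, φ (W ω) ∂μ := by
  rw [Fragility.condLawGE, integral_map hW.aemeasurable
    (measurable_of_countable φ).aestronglyMeasurable, ProbabilityTheory.cond,
    integral_smul_measure, ENNReal.toReal_inv, smul_eq_mul, measureReal_def]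

/-- The weights of the Poisson distribution conditioned to be positive, shifted to start at `0`. -/
noncomputable def condPoissonWeight (lam : ℝ) (k : ℕ) : ℝ :=
  Real.exp (-lam) * lam ^ (k + 1) / (k + 1).factorial / (1 - Real.exp (-lam))

theorem one_sub_exp_neg_pos {x : ℝ} (hx : 0 < x) : 0 < 1 - Real.exp (-x) :=
  sub_pos.2 (Real.exp_lt_one_iff.2 (neg_lt_zero.2 hx))

theorem condPoissonWeight_pos {lam : ℝ} (h : 0 < lam) (k : ℕ) : 0 < condPoissonWeight lam k := by
  have := one_sub_exp_neg_pos h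
  unfold condPoissonWeight
  positivity

theorem condPoissonWeight_rec (lam : ℝ) (k : ℕ) :
    (k + 2) * condPoissonWeight lam (k + 1) = lam * condPoissonWeight lam k := by
  have h1 : ((k + 1 + 1).factorial : ℝ) = (k + 2) * (k + 1).factorial := by
    rw [Nat.factorial_succ]; push_cast; ring
  have h2 : ((k + 1).factorial : ℝ) ≠ 0 := by exact_mod_cast Nat.factorial_ne_zero _
  unfold condPoissonWeight
  rw [h1]
  have h3 : (k : ℝ) + 2 ≠ 0 := by positivity
  -- When the denominator vanishes, all weights are `0` by the convention for division.
  rcases eq_or_ne (1 - Real.exp (-lam)) 0 with h0 | h0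
  · simp [h0]
  · field_simp
    ring

theorem hasSum_condPoissonWeight {lam : ℝ≥0} (h : 0 < lam) :
    HasSum (condPoissonWeight lam) 1 := by
  have hpos : 0 < 1 - Real.exp (-(lam : ℝ)) := one_sub_exp_neg_pos (by exact_mod_cast h)
  have := ((hasSum_nat_add_iff' 1).2 (hasSum_one_poissonMeasure lam)).div_const
    (1 - Real.exp (-(lam : ℝ)))
  simpa [div_self hpos.ne'] using! this

theorem integral_condPoisson (lam : ℝ≥0) (φ : ℕ → ℝ) :
    ∫ k, φ k ∂(Fragility.condPoisson 1 lam) =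
      ∑' k, condPoissonWeight lam k * φ (k + 1) := by
  have hset : {k : ℕ | 1 ≤ k} = {0}ᶜ := by ext k; simp [Nat.one_le_iff_ne_zero]
  rw [Fragility.condPoisson, integral_condLawGE _ measurable_id', hset,
    probReal_compl_eq_one_sub (measurableSet_singleton 0), poissonMeasure_real_singleton,
    ← integral_indicator (measurableSet_singleton 0).compl, integral_poissonMeasure,
    ← (Nat.succ_injective).tsum_eq, ← tsum_mul_left]
  · refine tsum_congr fun k => ?_
    simp [condPoissonWeight]
    ring
  · intro k hk
    cases k with
    | zero => simp at hk
    | succ k => exact ⟨k, rfl⟩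

/-- The solution of the Stein equation for the Poisson distribution conditioned to be positive. -/
noncomputable def condPoissonSteinSol (lam c : ℝ) (f : ℕ → ℝ) : ℕ → ℝ
  | 0 => 0
  | k + 1 => ((k + 1) * condPoissonSteinSol lam c f k + (f k - c)) / lam

theorem mul_condPoissonSteinSol_succ {lam : ℝ} (h : lam ≠ 0) (c : ℝ) (f : ℕ → ℝ) (k : ℕ) :
    lam * condPoissonSteinSol lam c f (k + 1) =
      (k + 1) * condPoissonSteinSol lam c f k + (f k - c) := by
  rw [condPoissonSteinSol, mul_div_cancel₀ _ h]

/-! ### The total variation bound -/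

theorem dTV_condLawGE_condPoisson_le {Ω : Type*} [MeasurableSpace Ω] {μ : Measure Ω}
    [IsProbabilityMeasure μ] {n : ℕ} {I : Fin n → Ω → ℕ}
    (hmeas : ∀ i, Measurable (I i)) (hind : iIndepFun I μ) (hI : ∀ i ω, I i ω = 0 ∨ I i ω = 1)
    {p : Fin n → ℝ} (hp : ∀ i, ∫ ω, (I i ω : ℝ) ∂μ = p i) {lam : ℝ≥0}
    (hlam : (lam : ℝ) = ∑ i, p i) (hpos : 0 < lam)
    (hW : 0 < μ.real {ω | 1 ≤ ∑ i, I i ω}) :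
    Fragility.dTV 1 (Fragility.condLawGE μ (fun ω => ∑ i, I i ω) 1)
        (Fragility.condPoisson 1 lam) ≤
      ((1 - Real.exp (-lam) - lam * Real.exp (-lam)) / (lam * (1 - Real.exp (-lam))) *
        ∑ i, p i ^ 2) / μ.real {ω | 1 ≤ ∑ i, I i ω} := by
  have hl : (0 : ℝ) < lam := by exact_mod_cast hpos
  have hmW : Measurable fun ω => ∑ i, I i ω := Finset.measurable_fun_sum _ fun i _ => hmeas i
  have hmS : MeasurableSet {ω | 1 ≤ ∑ i, I i ω} := measurableSet_le measurable_const hmW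
  have : Nonempty (Fragility.indicatorClass 1) := ⟨⟨_, ∅, Set.empty_subset _, rfl⟩⟩
  refine ciSup_le ?_
  rintro ⟨_, A, -, rfl⟩
  dsimp only
  set φ : ℕ → ℝ := A.indicator fun _ => 1 with hφ
  have hφ0 : ∀ k, 0 ≤ φ k := fun k => Set.indicator_nonneg (fun _ _ => zero_le_one) k
  have hφ1 : ∀ k, φ k ≤ 1 := fun k => Set.indicator_le' (fun _ _ => le_rfl)
    (fun _ _ => zero_le_one) k
  rw [integral_condLawGE μ hmW, integral_condPoisson]
  set c := ∑' k, condPoissonWeight lam k * φ (k + 1) with hc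
  set f : ℕ → ℝ := fun k => φ (k + 1) with hf
  set h := condPoissonSteinSol lam c f with hh
  have hstein : ∀ k, lam * h (k + 1) = (k + 1) * h k + (f k - c) :=
    mul_condPoissonSteinSol_succ hl.ne' c f
  have hC := abs_stein_increment_le hl (condPoissonWeight_pos hl) (condPoissonWeight_rec lam)
    (hasSum_condPoissonWeight hpos) (fun k => hφ0 (k + 1)) (fun k => hφ1 (k + 1))
    (rfl : h 0 = 0) hstein
  have hCeq : (1 - condPoissonWeight lam 0) / lam =
      (1 - Real.exp (-lam) - lam * Real.exp (-lam)) / (lam * (1 - Real.exp (-lam))) := by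
    have := (one_sub_exp_neg_pos hl).ne'
    simp only [condPoissonWeight, zero_add, pow_one, Nat.factorial_one, Nat.cast_one, div_one]
    field_simp
  rw [hCeq] at hC
  have hmain := abs_integral_stein_operator_le hmeas hind hI hp hC
  -- On `W = 0` the integrand is `lam * h 0 = 0`; this is why the solution starts at `0`.
  have heq : ∫ ω, ((∑ i, p i) * h (∑ i, I i ω) - (∑ i, I i ω : ℕ) * h (∑ i, I i ω - 1)) ∂μ =
      ∫ ω in {ω | 1 ≤ ∑ i, I i ω}, (φ (∑ i, I i ω) - c) ∂μ := by
    rw [← integral_indicator hmS]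
    refine integral_congr_ae (ae_of_all _ fun ω => ?_)
    simp only [Set.indicator_apply, Set.mem_ofPred_eq]
    rcases Nat.eq_zero_or_pos (∑ i, I i ω) with h0 | h1
    · simp [h0, hh, condPoissonSteinSol]
    · obtain ⟨k, hk⟩ := Nat.exists_eq_succ_of_ne_zero h1.ne'
      have := hstein k
      rw [if_pos (Nat.one_le_iff_ne_zero.2 h1.ne'), hk, ← hlam, Nat.succ_eq_add_one, this, Nat.add_sub_cancel]
      push_cast
      ring
  have hint : Integrable (fun ω => φ (∑ i, I i ω)) (μ.restrict {ω | 1 ≤ ∑ i, I i ω}) := by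
    refine Integrable.of_bound ((measurable_of_countable φ).comp hmW).aestronglyMeasurable 1
      (ae_of_all _ fun ω => ?_)
    rw [Real.norm_of_nonneg (hφ0 _)]
    exact hφ1 _
  rw [heq, integral_sub hint (integrable_const c), setIntegral_const, smul_eq_mul] at hmain
  rw [le_div_iff₀ hW, ← abs_of_pos hW, ← abs_mul, abs_of_pos hW]
  refine le_trans (le_of_eq ?_) hmain
  congr 1
  field_simp

/-- The complement is the event that all the variables vanish, which factors by independence. -/
theorem measureReal_one_le_sum {Ω ι : Type*} [Fintype ι] [MeasurableSpace Ω] {μ : Measure Ω}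
    [IsProbabilityMeasure μ] {I : ι → Ω → ℕ} (hmeas : ∀ i, Measurable (I i))
    (hind : iIndepFun I μ) :
    μ.real {ω | 1 ≤ ∑ i, I i ω} = 1 - ∏ i, (1 - μ.real {ω | 1 ≤ I i ω}) := by
  have hmW : Measurable fun ω => ∑ i, I i ω := Finset.measurable_fun_sum _ fun i _ => hmeas i
  have hset : {ω | 1 ≤ ∑ i, I i ω} = (⋂ i ∈ Finset.univ, I i ⁻¹' {0})ᶜ := by
    ext ω
    simp [Nat.one_le_iff_ne_zero]
  rw [hset, probReal_compl_eq_one_sub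
    (Finset.measurableSet_biInter _ fun i _ => hmeas i (measurableSet_singleton 0)),
    measureReal_def, hind.measure_inter_preimage_eq_mul Finset.univ
      (sets := fun _ => {0}) fun _ _ => measurableSet_singleton 0, ENNReal.toReal_prod]
  congr 1
  refine Finset.prod_congr rfl fun i _ => ?_
  have : I i ⁻¹' {0} = {ω | 1 ≤ I i ω}ᶜ := by
    ext ω
    simp
  rw [this, ← measureReal_def, probReal_compl_eq_one_sub
    (measurableSet_le measurable_const (hmeas i))]

theorem mainTheorem10 (n : ℕ) :
    (∀ (Ω : Type*) [MeasurableSpace Ω] (μ : Measure Ω) [IsProbabilityMeasure μ]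
      (X : Fin n → Ω → ℝ) (s : ℝ) (p : Fin n → ℝ) (lam : ℝ≥0),
      (∀ i, Measurable (X i)) →
      iIndepFun X μ →
      (∀ i, μ.real {ω | X i ω > s} = p i) →
      (lam : ℝ) = ∑ i, p i →
      0 < lam →
      Fragility.dTV 1 (Fragility.condLawGE μ (Fragility.numExceed X s) 1)
          (Fragility.condPoisson 1 lam)
        ≤ Fragility.errorBound p) ∧
    (1 ≤ n →
      IsEquivalent (𝓝[>] (0 : ℝ)) (fun q : ℝ => Fragility.errorBound (fun _ : Fin n => q))
        (fun q : ℝ => q / 2)) := by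
  refine ⟨?_, isEquivalent_errorBound⟩
  intro Ω _ μ _ X s p lam hX hind hp hlam hpos
  have hg : Measurable ((Set.Ioi s).indicator fun _ : ℝ => (1 : ℕ)) :=
    measurable_const.indicator measurableSet_Ioi
  set I : Fin n → Ω → ℕ := fun i ω => (Set.Ioi s).indicator (fun _ => 1) (X i ω) with hIdef
  have hmeas : ∀ i, Measurable (I i) := fun i => hg.comp (hX i)
  have hindI : iIndepFun I μ := hind.comp _ fun _ => hg
  have hI : ∀ i ω, I i ω = 0 ∨ I i ω = 1 := fun i ω => Set.indicator_eq_zero_or_self _ _ _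
  have hset : ∀ i, {ω | 1 ≤ I i ω} = {ω | X i ω > s} := fun i => by
    ext ω
    by_cases h : s < X i ω <;> simp [hIdef, h]
  have hpI : ∀ i, ∫ ω, (I i ω : ℝ) ∂μ = p i := fun i => by
    rw [← hp i, ← integral_indicator_one (measurableSet_lt measurable_const (hX i))]
    refine integral_congr_ae (ae_of_all _ fun ω => ?_)
    by_cases h : s < X i ω <;> simp [hIdef, h]
  have hP := measureReal_one_le_sum hmeas hindI
  simp_rw [hset, hp] at hP
  have hW : 0 < μ.real {ω | 1 ≤ ∑ i, I i ω} := by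
    have hl : (0 : ℝ) < ∑ i, p i := by rw [← hlam]; exact_mod_cast hpos
    -- Some `p i` is positive, and an exceedance by that `X i` forces `W ≥ 1`.
    obtain ⟨i, -, hi⟩ := Finset.exists_lt_of_sum_lt (s := Finset.univ) (f := fun _ => (0 : ℝ))
      (g := p) (by simpa using hl)
    rw [← hp i, ← hset i] at hi
    refine hi.trans_le (measureReal_mono fun ω (hω : 1 ≤ I i ω) => ?_)
    exact hω.trans (Finset.single_le_sum (f := fun j => I j ω) (fun _ _ => Nat.zero_le _)
      (Finset.mem_univ i))
  have := dTV_condLawGE_condPoisson_le hmeas hindI hI hpI hlam hpos hW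
  rw [hP, hlam] at this
  exact this
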